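/- **Theorem 3.2.** Let $0<L<U$ and $0<\beta<\frac{U-L}{2}$. An input of OCS-min consists of a horizon $T$, rate constraints $d_1,\dots,d_T\in[0,1]$ with $\sum_{t} d_t\ge 1$, and convex cost functions $g_1,\dots,g_T$ on $[0,1]$ with $g_t(0)=0$, $g_t\ge 0$ and $L\le g_t'\le U$. A decision sequence $x_1,\dots,x_T$ is feasible if $0\le x_t\le d_t$ for all $t$ and $\sum_{t=1}^T x_t=1$; its cost is $$\sum_{t=1}^T g_t(x_t)+\sum_{t=1}^{T+1}\beta\,|x_t-x_{t-1}|,\qquad x_0=x_{T+1}=0 .$$ $\mathrm{OPT}(I)$ denotes the minimum cost of a feasible decision sequence for the input $I$. A deterministic online algorithm knows $T$ and $d_1,\dots,d_T$ in advance, and chooses $x_t$ as a function of $T$, $d_1,\dots,d_T$ and $g_1,\dots,g_t$; it must produce a feasible sequence on every input under consideration, and $\mathrm{ALG}(I)$ denotes its cost on $I$. For $N\ge 0$ let $\Omega_N$ be the set of inputs with $\sum_{t>N} d_t\ge 1$, so that no compulsory trade is needed in the first $N$ steps ($\Omega_0$ is the set of all inputs). Let $$\alpha=\left[W\!\left(\Big(\tfrac{2\beta}{U}+\tfrac{L}{U}-1\Big)e^{2\beta/U-1}\right)-\tfrac{2\beta}{U}+1\right]^{-1},$$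 where $W$ is the principal branch of the Lambert function, i.e. the inverse of $x\mapsto xe^x$ on $[-1,\infty)$. Then no deterministic online algorithm for OCS-min has a competitive ratio better than $\alpha$: for every $N\ge 0$ and every deterministic online algorithm for the inputs in $\Omega_N$, $$\sup_{I\in\Omega_N}\frac{\mathrm{ALG}(I)}{\mathrm{OPT}(I)}\ \ge\ \alpha .$$ -/

import Mathlib

namespace OCS

/-- An input of the online conversion problem with total demand `1`: a horizon `T`, rate
constraints `d t` and cost functions `g t`. The time step `t ∈ {1, …, T}` of the problem is the
index `t - 1` of `Fin T`. -/
structure Instance where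
  T : ℕ
  d : Fin T → ℝ
  g : Fin T → ℝ → ℝ

/-- Admissible cost functions: convex on `[0, 1]`, zero at `0`, nonnegative, and differentiable on
`[0, 1]` (one-sidedly at the end points) with derivative between `L` and `U`. -/
structure IsCostFunction (L U : ℝ) (g : ℝ → ℝ) : Prop where
  convexOn : ConvexOn ℝ (Set.Icc 0 1) g
  map_zero : g 0 = 0
  nonneg : ∀ x ∈ Set.Icc (0 : ℝ) 1, 0 ≤ g x
  deriv_bounds : ∀ x ∈ Set.Icc (0 : ℝ) 1,
    ∃ g' : ℝ, HasDerivWithinAt g g' (Set.Icc 0 1) x ∧ L ≤ g' ∧ g' ≤ U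

/-- The set of valid inputs in which no compulsory trade is needed during the first `N` steps:
after step `N` the remaining rate constraints still add up to at least the whole demand.
For `N = 0` the last condition says exactly that the input is feasible (`∑ t, d t ≥ 1`), so
`validInstances L U 0` is the set of all feasible inputs. -/
def validInstances (L U : ℝ) (N : ℕ) : Set Instance :=
  {I | (∀ t, 0 ≤ I.d t ∧ I.d t ≤ 1) ∧ (∀ t, IsCostFunction L U (I.g t)) ∧
    1 ≤ ∑ t ∈ Finset.univ.filter (fun t : Fin I.T => N ≤ (t : ℕ)), I.d t}

/-- A sequence of decisions `x_1, …, x_T` extended by `x_0 = 0` and `x_t = 0` for `t > T`. -/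
def extend {T : ℕ} (x : Fin T → ℝ) : ℕ → ℝ
  | 0 => 0
  | t + 1 => if h : t < T then x ⟨t, h⟩ else 0

/-- Purchasing cost plus switching cost
`∑_{t=1}^{T} g_t(x_t) + ∑_{t=1}^{T+1} β |x_t - x_{t-1}|`. -/
noncomputable def cost (β : ℝ) (I : Instance) (x : Fin I.T → ℝ) : ℝ :=
  ∑ t, I.g t (x t) + ∑ t ∈ Finset.range (I.T + 1), β * |extend x (t + 1) - extend x t|

/-- The feasible decision sequences: rate constraints and deadline constraint. -/
def feasible (I : Instance) : Set (Fin I.T → ℝ) :=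
  {x | (∀ t, 0 ≤ x t ∧ x t ≤ I.d t) ∧ ∑ t, x t = 1}

/-- The offline optimal cost. -/
noncomputable def opt (β : ℝ) (I : Instance) : ℝ :=
  sInf (cost β I '' feasible I)

/-- A deterministic online algorithm. The horizon `T` and the rate constraints `d` are known in
advance. The decision at time `t` is a function of these and of the list `[g_1, …, g_t]` of
the cost functions revealed so far (its own earlier decisions are determined by these data). -/
structure OnlineAlgorithm where
  decide : (T : ℕ) → (d : Fin T → ℝ) → List (ℝ → ℝ) → ℝ

namespace OnlineAlgorithm

/-- The decisions that the algorithm takes on the input `I`. -/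
def run (A : OnlineAlgorithm) (I : Instance) : Fin I.T → ℝ :=
  fun t => A.decide I.T I.d ((List.ofFn I.g).take (t + 1))

/-- The algorithm produces a feasible decision sequence on every input in `Ω`. -/
def Solves (A : OnlineAlgorithm) (Ω : Set Instance) : Prop :=
  ∀ I ∈ Ω, A.run I ∈ feasible I

/-- The competitive ratio over the set of inputs `Ω`: the supremum of `ALG(I) / OPT(I)`. -/
noncomputable def competitiveRatio (A : OnlineAlgorithm) (β : ℝ) (Ω : Set Instance) : EReal :=
  ⨆ I ∈ Ω, ((cost β I (A.run I) / opt β I : ℝ) : EReal)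

end OnlineAlgorithm

/-- The principal branch of the Lambert `W` function: the inverse of `x ↦ x * exp x` on
`[-1, ∞)`. -/
noncomputable def lambertW (z : ℝ) : ℝ :=
  Function.invFunOn (fun x : ℝ => x * Real.exp x) (Set.Ici (-1)) z

/-- `α = [W((2β/U + L/U - 1) e^{2β/U - 1}) - 2β/U + 1]⁻¹`. -/
noncomputable def alpha (L U β : ℝ) : ℝ :=
  (lambertW ((2 * β / U + L / U - 1) * Real.exp (2 * β / U - 1)) - 2 * β / U + 1)⁻¹

end OCS

namespace OCS

/-! Linear costs with all rate constraints equal to 1 suffice, so the adversary names prices and an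
algorithm becomes a policy on price histories. U + `excess` bounds its final cost from below when
all later prices are U. A block of K steps at price p brings the optimum down to p + 2β/K, because
spreading the demand over the block makes switching cheap. The policy cannot exploit this. The
adversary shows U until the purchase rate is tiny, then offers the block but cuts it short as soon
as the rate jumps. A jump costs about 2β per unit for going up and back down, so the effective price
is p + 2β; without a jump almost nothing is bought (`IsPolicy.run_dichotomy`). Each interruption
consumes a fixed amount of demand, so some block is completed (`IsPolicy.exists_block`). Let p fall
towards L and let w be the amount bought. Up to small errors, `excess` drops by at most (U - 2β - p)
dw, while r-competitiveness forces U + `excess` ≤ r p. Discretised along p = U - 2β - c q^i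
(`IsPolicy.ratio_bound`), this yields in the limit (U - r(U - 2β - c))/c + r s ≤ 1, where c e^s = U
- 2β - L (`OnlineAlgorithm.Solves.ratio_bound`). For s = 1/α and starting price U/α this fails
whenever r < α; `inv_alpha_spec` supplies these values. -/

/-- The amount bought along a price history (most recent price first), when `X h` is the amount
bought at the last step of the history `h`. -/
def bought (X : List ℝ → ℝ) : List ℝ → ℝ
  | [] => 0
  | p :: l => X (p :: l) + bought X l

/-- The purchasing and switching cost along a price history (most recent price first). -/
def spent (β : ℝ) (X : List ℝ → ℝ) : List ℝ → ℝ
  | [] => 0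
  | p :: l => p * X (p :: l) + β * |X (p :: l) - X l| + spent β X l

/-- The cost of returning to zero after the history `l`, relative to buying everything at the
price `U`. -/
def excess (U β : ℝ) (X : List ℝ → ℝ) (l : List ℝ) : ℝ :=
  spent β X l + β * X l - U * bought X l

/-- Price histories of length at most `T` with prices between `L` and `U`. -/
def IsHistory (L U : ℝ) (T : ℕ) (l : List ℝ) : Prop :=
  l.length ≤ T ∧ ∀ p ∈ l, L ≤ p ∧ p ≤ U

/-- `X` describes nonnegative purchases that never exceed one unit in total. -/
structure IsPolicy (L U : ℝ) (T : ℕ) (X : List ℝ → ℝ) : Prop where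
  map_nil : X [] = 0
  nonneg : ∀ l, IsHistory L U T l → 0 ≤ X l
  bought_le : ∀ l, IsHistory L U T l → bought X l ≤ 1

/-- The history `l` contains `K` consecutive steps at the price `p`. -/
def HasBlock (K : ℕ) (p : ℝ) (l : List ℝ) : Prop :=
  ∃ l₁ l₂, l = l₁ ++ (List.replicate K p ++ l₂)

/-! ### The adversary's game against a policy -/

section Game

variable {L U β : ℝ} {T : ℕ} {X : List ℝ → ℝ}

lemma IsHistory.replicate_append {l : List ℝ} {p : ℝ} {k : ℕ} (hl : IsHistory L U T l)
    (hp : L ≤ p) (hp' : p ≤ U) (hk : l.length + k ≤ T) :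
    IsHistory L U T (List.replicate k p ++ l) := by
  refine ⟨by simp; omega, fun q hq => ?_⟩
  rcases List.mem_append.1 hq with h | h
  · rw [List.eq_of_mem_replicate h]; exact ⟨hp, hp'⟩
  · exact hl.2 q h

lemma IsHistory.tail {l : List ℝ} {p : ℝ} (hl : IsHistory L U T (p :: l)) :
    IsHistory L U T l :=
  ⟨(Nat.le_succ _).trans hl.1, fun q hq => hl.2 q (List.mem_cons_of_mem _ hq)⟩

/-- The return to zero is prepaid in `excess`, so raising the rate costs 2β per unit and lowering it
costs nothing. -/
lemma excess_cons (p : ℝ) (l : List ℝ) :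
    excess U β X (p :: l) =
      excess U β X l - (U - p) * X (p :: l) + β * (|X (p :: l) - X l| + X (p :: l) - X l) := by
  simp only [excess, spent, bought]; ring

lemma excess_cons_ge (hβ : 0 < β) (p : ℝ) (l : List ℝ) :
    excess U β X l - (U - p) * X (p :: l) ≤ excess U β X (p :: l) := by
  rw [excess_cons]
  have := mul_nonneg hβ.le (by linarith [neg_abs_le (X (p :: l) - X l)] :
    0 ≤ |X (p :: l) - X l| + X (p :: l) - X l)
  linarith

lemma excess_cons_ge_of_increase (hβ : 0 < β) (p : ℝ) (l : List ℝ) :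
    excess U β X l - (U - p) * X (p :: l) + 2 * β * (X (p :: l) - X l) ≤
      excess U β X (p :: l) := by
  rw [excess_cons]
  nlinarith [le_abs_self (X (p :: l) - X l)]

lemma excess_replicate_ge (hβ : 0 < β) (p : ℝ) (l : List ℝ) (k : ℕ) :
    excess U β X l - (U - p) * (bought X (List.replicate k p ++ l) - bought X l) ≤
      excess U β X (List.replicate k p ++ l) := by
  induction k with
  | zero => simp
  | succ k ih =>
    have := excess_cons_ge (U := U) (X := X) hβ p (List.replicate k p ++ l)
    simp only [List.replicate_succ, List.cons_append, bought] at *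
    linarith

lemma excess_replicate_top_ge (hβ : 0 < β) (l : List ℝ) (k : ℕ) :
    excess U β X l ≤ excess U β X (List.replicate k U ++ l) := by
  simpa using excess_replicate_ge (U := U) (X := X) hβ U l k

lemma bought_mono_replicate (hX : ∀ l, IsHistory L U T l → 0 ≤ X l) {l : List ℝ} {p : ℝ} {k : ℕ}
    (hl : IsHistory L U T (List.replicate k p ++ l)) :
    bought X l ≤ bought X (List.replicate k p ++ l) := by
  induction k with
  | zero => simp
  | succ k ih =>
    simp only [List.replicate_succ, List.cons_append, bought] at *
    linarith [hX _ hl, ih hl.tail]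

/-- During a sufficiently long run of the highest price the purchase rate becomes small. -/
lemma IsPolicy.exists_small_rate (hX : IsPolicy L U T X) (hLU : L ≤ U) {ε : ℝ}
    {H : ℕ} (hH : 1 < H * ε) {l : List ℝ} (hl : IsHistory L U T l) (hlen : l.length + H ≤ T)
    (hb : 0 ≤ bought X l) :
    ∃ k ≤ H, X (List.replicate k U ++ l) ≤ ε := by
  by_contra! h
  have key : ∀ k ≤ H, bought X l + k * ε ≤ bought X (List.replicate k U ++ l) := by
    intro k
    induction k with
    | zero => simp
    | succ k ih =>
      intro hk
      have h1 := ih (by omega)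
      have h2 := h (k + 1) hk
      simp only [List.replicate_succ, List.cons_append, bought] at *
      push_cast
      linarith
  have h1 := key H le_rfl
  have h2 := hX.bought_le _ (hl.replicate_append hLU le_rfl hlen)
  linarith

/-- A run of `K` steps at the price `p`, interrupted as soon as the purchase rate jumps. -/
lemma IsPolicy.run_dichotomy (hX : IsPolicy L U T X) (hβ : 0 < β) {p δ ε M : ℝ} (hp : L ≤ p)
    (hp' : p ≤ U) (hε : 0 < ε) (hδ : 0 < δ) (hM : 4 * β = δ * M) (hM0 : 0 < M)
    {l : List ℝ} (hl : IsHistory L U T l) (hx : X l ≤ ε) (k : ℕ) (hk : l.length + k ≤ T) :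
    (X (List.replicate k p ++ l) ≤ ε * (1 + M) ^ k ∧
      bought X (List.replicate k p ++ l) - bought X l ≤ ε * (1 + M) ^ k) ∨
    ∃ i ≤ k, bought X l + M * ε ≤ bought X (List.replicate i p ++ l) ∧
      excess U β X l -
        (U - 2 * β - p + δ) * (bought X (List.replicate i p ++ l) - bought X l) ≤
        excess U β X (List.replicate i p ++ l) := by
  induction k with
  | zero => left; simp; exact ⟨hx, hε.le⟩
  | succ k ih =>
    rcases ih (by omega) with ⟨h1, h2⟩ | ⟨i, hi, h⟩
    · have hhist := hl.replicate_append hp hp' hk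
      have hhist' := hl.replicate_append hp hp' (k := k) (by omega)
      have hmono := bought_mono_replicate hX.nonneg hhist'
      have hx0 := hX.nonneg _ hhist
      have hge := excess_replicate_ge (U := U) (X := X) hβ p l k
      have hinc := excess_cons_ge_of_increase (U := U) (X := X) hβ p (List.replicate k p ++ l)
      have hη : ε ≤ ε * (1 + M) ^ k :=
        le_mul_of_one_le_right hε.le (one_le_pow₀ (by linarith))
      set η := ε * (1 + M) ^ k with hηdef
      have hη' : ε * (1 + M) ^ (k + 1) = η + M * η := by rw [hηdef]; ring
      by_cases hq : X (List.replicate (k + 1) p ++ l) ≤ M * η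
      · left
        rw [hη']
        refine ⟨by linarith, ?_⟩
        simp only [List.replicate_succ, List.cons_append, bought] at *
        linarith
      · right
        push Not at hq
        refine ⟨k + 1, le_rfl, ?_⟩
        simp only [List.replicate_succ, List.cons_append, bought] at *
        set s := bought X (List.replicate k p ++ l) with hs
        set y := X (p :: (List.replicate k p ++ l)) with hy
        have hMη := mul_le_mul_of_nonneg_left hη hM0.le
        refine ⟨by linarith, ?_⟩
        -- The slack δy exceeds 4βη, which covers 2β times the previous rate and 2β times the amount
        -- bought before the jump, each at most 2βη.
        have e1 : δ * (M * η) ≤ δ * y := mul_le_mul_of_nonneg_left hq.le hδ.le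
        have e2 : δ * (M * η) = 4 * β * η := by rw [hM]; ring
        have e3 := mul_le_mul_of_nonneg_left h1 hβ.le
        have e4 := mul_le_mul_of_nonneg_left h2 hβ.le
        have e5 : 0 ≤ δ * (s - bought X l) := mul_nonneg hδ.le (by linarith)
        nlinarith
    · exact Or.inr ⟨i, by omega, h⟩

/-- After a run of the highest price, the adversary offers `K` steps at the price `p`. Either all of
them are used up without a noticeable purchase, or the policy makes progress at an effective price
of about `p + 2 * β`. -/
lemma IsPolicy.exists_block_or_progress (hX : IsPolicy L U T X) (hβ : 0 < β) (hLU : L ≤ U)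
    {p δ ε M : ℝ} (hp : L ≤ p) (hp' : p ≤ U - 2 * β) (hε : 0 < ε) (hδ : 0 < δ)
    (hM : 4 * β = δ * M) (hM0 : 0 < M) {K H : ℕ} (hH : 1 < H * ε)
    (hK : (U - L) * (ε * (1 + M) ^ K) ≤ δ) {l : List ℝ} (hl : IsHistory L U T l)
    (hb : 0 ≤ bought X l) (hlen : l.length + (H + K) ≤ T) :
    ∃ l' : List ℝ, IsHistory L U T l' ∧ l'.length ≤ l.length + (H + K) ∧
      bought X l ≤ bought X l' ∧
      ((HasBlock K p l' ∧
        excess U β X l - (U - 2 * β - p + δ) * (bought X l' - bought X l) - δ ≤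
          excess U β X l') ∨
      (bought X l + M * ε ≤ bought X l' ∧
        excess U β X l - (U - 2 * β - p + δ) * (bought X l' - bought X l) ≤
          excess U β X l')) := by
  have hpU : p ≤ U := by linarith
  obtain ⟨k, hk, hsmall⟩ := hX.exists_small_rate hLU hH hl (by omega) hb
  have hl₁ := hl.replicate_append hLU le_rfl (k := k) (by omega)
  have hmono := bought_mono_replicate hX.nonneg hl₁
  have htop := excess_replicate_top_ge (U := U) (X := X) hβ l k
  have hlen₁ : (List.replicate k U ++ l).length = k + l.length := by simp
  set l₁ := List.replicate k U ++ l
  -- Purchases at price U do not lower `excess`, so charging them at the effective price is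
  -- harmless; this uses p ≤ U - 2β.
  have hcost : 0 ≤ (U - 2 * β - p + δ) * (bought X l₁ - bought X l) :=
    mul_nonneg (by linarith) (by linarith)
  rcases hX.run_dichotomy hβ hp hpU hε hδ hM hM0 hl₁ hsmall K (by omega) with
    ⟨-, h2⟩ | ⟨i, hi, h1, h2⟩
  · have hl₂ := hl₁.replicate_append hp hpU (k := K) (by omega)
    have hmono₂ := bought_mono_replicate hX.nonneg hl₂
    have hge := excess_replicate_ge (U := U) (X := X) hβ p l₁ K
    refine ⟨_, hl₂, by simp [hlen₁]; omega, by linarith, Or.inl ⟨⟨[], l₁, rfl⟩, ?_⟩⟩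
    have h3 : (U - p) * (bought X (List.replicate K p ++ l₁) - bought X l₁) ≤
        (U - L) * (ε * (1 + M) ^ K) :=
      mul_le_mul (by linarith) h2 (by linarith) (by linarith)
    have h4 : 0 ≤ (U - 2 * β - p + δ) * (bought X (List.replicate K p ++ l₁) - bought X l) :=
      mul_nonneg (by linarith) (by linarith)
    linarith
  · have hMε := mul_pos hM0 hε
    exact ⟨_, hl₁.replicate_append hp hpU (k := i) (by omega), by simp [hlen₁]; omega,
      by linarith, Or.inr ⟨by linarith, by linarith⟩⟩

/-- The adversary can offer `K` consecutive steps at the price `p` such that the policy essentially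
pays `p + 2 * β` for everything it buys below the price `U`. -/
lemma IsPolicy.exists_block (hX : IsPolicy L U T X) (hβ : 0 < β) (hLU : L ≤ U) {p δ ε M : ℝ}
    (hp : L ≤ p) (hp' : p ≤ U - 2 * β) (hε : 0 < ε) (hδ : 0 < δ) (hM : 4 * β = δ * M)
    (hM0 : 0 < M) {K H : ℕ} (hH : 1 < H * ε) (hK : (U - L) * (ε * (1 + M) ^ K) ≤ δ) (n : ℕ) :
    ∀ l : List ℝ, IsHistory L U T l → 0 ≤ bought X l → 1 - bought X l ≤ n * (M * ε) →
      l.length + (n + 1) * (H + K) ≤ T →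
      ∃ l' : List ℝ, IsHistory L U T l' ∧ HasBlock K p l' ∧
        l'.length ≤ l.length + (n + 1) * (H + K) ∧ bought X l ≤ bought X l' ∧
        excess U β X l - (U - 2 * β - p + δ) * (bought X l' - bought X l) - δ ≤
          excess U β X l' := by
  have hMε := mul_pos hM0 hε
  induction n with
  | zero =>
    intro l hl hb hrem hlen
    rw [zero_add, one_mul] at hlen ⊢
    obtain ⟨l', hl', hlen', hmono, ⟨hblock, hexc⟩ | ⟨hprog, -⟩⟩ :=
      hX.exists_block_or_progress hβ hLU hp hp' hε hδ hM hM0 hH hK hl hb hlen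
    · exact ⟨l', hl', hblock, hlen', hmono, hexc⟩
    -- No demand is left, so progress by Mε > 0 is impossible.
    · have := hX.bought_le _ hl'
      rw [Nat.cast_zero, zero_mul] at hrem
      linarith
  | succ n ih =>
    intro l hl hb hrem hlen
    have hexp : (n + 1 + 1) * (H + K) = (n + 1) * (H + K) + (H + K) := by ring
    rw [hexp] at hlen ⊢
    obtain ⟨l₁, hl₁, hlen₁, hmono₁, ⟨hblock, hexc⟩ | ⟨hprog, hexc₁⟩⟩ :=
      hX.exists_block_or_progress hβ hLU hp hp' hε hδ hM hM0 hH hK hl hb (by omega)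
    · exact ⟨l₁, hl₁, hblock, by omega, hmono₁, hexc⟩
    · push_cast at hrem
      obtain ⟨l', hl', hblock, hlen', hmono', hexc⟩ :=
        ih l₁ hl₁ (by linarith) (by linarith) (by omega)
      exact ⟨l', hl', hblock, by omega, by linarith, by linarith⟩

/-- A policy whose cost is at most `r * (p + 2 * β / K)` whenever the prices contain `K` consecutive
steps at the price `p` satisfies the discretised differential inequality of the threshold
function. -/
lemma IsPolicy.ratio_bound (hX : IsPolicy L U T X) (hβ : 0 < β) (hLU : L ≤ U) {δ ε M r : ℝ}
    (hε : 0 < ε) (hδ : 0 < δ) (hM : 4 * β = δ * M) (hM0 : 0 < M) {K H n : ℕ} (hH : 1 < H * ε)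
    (hK : (U - L) * (ε * (1 + M) ^ K) ≤ δ) (hn : 1 ≤ n * (M * ε))
    (hr : ∀ l p, IsHistory L U T l → HasBlock K p l →
      U + excess U β X l ≤ r * (p + 2 * β / K))
    {c q : ℝ} (hc : 0 < c) (hq : 1 ≤ q) (m : ℕ) (hcm : c * q ^ m ≤ U - 2 * β - L)
    (hT : (m + 1) * ((n + 1) * (H + K)) ≤ T) :
    (U - r * (U - 2 * β - c) - r * (2 * β / K) - 2 * δ) / c +
      m * (r * (1 - 1 / q) - 2 * δ / c) ≤ 1 := by
  have hq0 : 0 < q := by linarith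
  -- The potential is the amount bought plus the competitive slack, which is at most 0, divided by c
  -- q^i. Each block raises it by at least r(1 - 1/q) - 2δ/c.
  have key : ∀ i ≤ m, ∃ l, IsHistory L U T l ∧ HasBlock K (U - 2 * β - c * q ^ i) l ∧
      l.length ≤ (i + 1) * ((n + 1) * (H + K)) ∧ 0 ≤ bought X l ∧
      (U - r * (U - 2 * β - c) - r * (2 * β / K) - 2 * δ) / c +
        i * (r * (1 - 1 / q) - 2 * δ / c) ≤ bought X l +
        (excess U β X l + U - r * (U - 2 * β - c * q ^ i + 2 * β / K)) / (c * q ^ i) := by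
    intro i
    induction i with
    | zero =>
      intro _
      have h0 : IsHistory L U T [] := ⟨by simp, by simp⟩
      obtain ⟨l', hl', hb, hlen, hmono, hexc⟩ := hX.exists_block (p := U - 2 * β - c) hβ hLU
        (by nlinarith [one_le_pow₀ (n := m) hq]) (by linarith) hε hδ hM hM0 hH hK n [] h0
        (by simp [bought]) (by simpa [bought] using hn)
        (by simp; nlinarith)
      have hle := hX.bought_le _ hl'
      have h1 : excess U β X [] = 0 := by simp [bought, excess, spent, hX.map_nil]
      have h2 : bought X [] = 0 := rfl
      rw [h2] at hmono
      rw [h1, h2] at hexc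
      refine ⟨l', hl', by simpa using hb, by simpa using hlen, hmono, ?_⟩
      rw [pow_zero, mul_one, Nat.cast_zero, zero_mul, add_zero, add_div' _ _ _ hc.ne']
      refine div_le_div_of_nonneg_right ?_ hc.le
      nlinarith
    | succ i ih =>
      intro hi
      obtain ⟨l, hl, hb, hlen, h0, hV⟩ := ih (by omega)
      have hpos : 0 < c * q ^ i := by positivity
      have hpos' : 0 < c * q ^ (i + 1) := by positivity
      have hle_c : c * q ^ (i + 1) ≤ c * q ^ m :=
        mul_le_mul_of_nonneg_left (pow_le_pow_right₀ hq hi) hc.le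
      have hle_c' : c ≤ c * q ^ (i + 1) := le_mul_of_one_le_right hc.le (one_le_pow₀ hq)
      have hle_c'' : c * q ^ i ≤ c * q ^ (i + 1) :=
        mul_le_mul_of_nonneg_left (pow_le_pow_right₀ hq (Nat.le_succ i)) hc.le
      have hlen' : (i + 1 + 1) * ((n + 1) * (H + K)) =
          (i + 1) * ((n + 1) * (H + K)) + (n + 1) * (H + K) := by ring
      have hlen'' : (i + 1 + 1) * ((n + 1) * (H + K)) ≤ (m + 1) * ((n + 1) * (H + K)) :=
        Nat.mul_le_mul_right _ (by omega)
      obtain ⟨l', hl', hb', hlen₁, hmono, hexc⟩ :=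
        hX.exists_block (p := U - 2 * β - c * q ^ (i + 1)) hβ hLU
        (by linarith) (by linarith) hε hδ hM hM0 hH hK n l hl h0 (by linarith) (by omega)
      have hle := hX.bought_le _ hl'
      refine ⟨l', hl', hb', by omega, by linarith, ?_⟩
      have hE := hr _ _ hl hb
      set E := excess U β X l + U - r * (U - 2 * β - c * q ^ i + 2 * β / K) with hEdef
      have hE0 : E ≤ 0 := by linarith
      -- Competitiveness after the previous block is used here: since E ≤ 0, enlarging the
      -- denominator raises the quotient.
      have h1 : E / (c * q ^ i) ≤ E / (c * q ^ (i + 1)) := by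
        rw [div_le_div_iff₀ hpos hpos']
        exact mul_le_mul_of_nonpos_left hle_c'' hE0
      have h2 : 2 * δ / (c * q ^ (i + 1)) ≤ 2 * δ / c :=
        div_le_div_of_nonneg_left (by linarith) hc hle_c'
      have h3 : r * (1 - 1 / q) =
          r * (c * q ^ (i + 1) - c * q ^ i) / (c * q ^ (i + 1)) := by
        field_simp
        ring
      have h4 : bought X l + E / (c * q ^ (i + 1)) - 2 * δ / (c * q ^ (i + 1)) +
          r * (c * q ^ (i + 1) - c * q ^ i) / (c * q ^ (i + 1)) ≤
          bought X l' + (excess U β X l' + U -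
            r * (U - 2 * β - c * q ^ (i + 1) + 2 * β / K)) / (c * q ^ (i + 1)) := by
        rw [add_div' _ (bought X l) _ hpos'.ne', add_div' _ (bought X l') _ hpos'.ne', ← sub_div,
          ← add_div]
        refine div_le_div_of_nonneg_right ?_ hpos'.le
        -- One δ per unit over at most one unit, plus the δ of the completed block, gives 2δ.
        have h5 : δ * (bought X l' - bought X l) ≤ δ * 1 :=
          mul_le_mul_of_nonneg_left (by linarith) hδ.le
        rw [hEdef]
        linarith
      push_cast
      linarith
  obtain ⟨l, hl, hb, -, -, h⟩ := key m le_rfl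
  have h1 := hr _ _ hl hb
  have h2 := hX.bought_le _ hl
  have h3 : (excess U β X l + U - r * (U - 2 * β - c * q ^ m + 2 * β / K)) / (c * q ^ m) ≤ 0 :=
    div_nonpos_of_nonpos_of_nonneg (by linarith) (by positivity)
  linarith

end Game

/-! ### Linear inputs and price histories -/

/-- The input with linear costs whose slopes are given by `l`, most recent price first, and without
effective rate constraints. -/
def linearInstance (T : ℕ) (l : List ℝ) : Instance where
  T := T
  d := fun _ => 1
  g := fun t x => l.reverse.getD t 0 * x

open Classical in
/-- The decisions of an online algorithm on linear costs as a function of the price history. -/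
noncomputable def OnlineAlgorithm.policy (A : OnlineAlgorithm) (T : ℕ) (l : List ℝ) : ℝ :=
  -- The value 0 on the empty history encodes x_0 = 0.
  if l = [] then 0 else A.decide T (fun _ => 1) (l.reverse.map fun p x => p * x)

lemma isCostFunction_linear {L U p : ℝ} (hL : 0 ≤ L) (hp : L ≤ p) (hp' : p ≤ U) :
    IsCostFunction L U fun x => p * x where
  convexOn := by
    refine ⟨convex_Icc 0 1, fun x _ y _ a b _ _ _ => le_of_eq ?_⟩
    simp only [smul_eq_mul]
    ring
  map_zero := mul_zero p
  nonneg x hx := mul_nonneg (hL.trans hp) hx.1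
  deriv_bounds x _ := ⟨p, by simpa using (hasDerivWithinAt_id x _).const_mul p, hp, hp'⟩

lemma getD_reverse_bounds {L U : ℝ} {l : List ℝ} (hl : ∀ p ∈ l, L ≤ p ∧ p ≤ U) {t : ℕ}
    (ht : t < l.length) : L ≤ l.reverse.getD t 0 ∧ l.reverse.getD t 0 ≤ U := by
  rw [List.getD_eq_getElem _ _ (by simpa using ht)]
  exact hl _ (List.mem_reverse.1 (List.getElem_mem _))

lemma linearInstance_mem_validInstances {L U : ℝ} (hL : 0 ≤ L) {N T : ℕ} (hN : N < T)
    {l : List ℝ} (hl : ∀ p ∈ l, L ≤ p ∧ p ≤ U) (hT : l.length = T) :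
    linearInstance T l ∈ validInstances L U N := by
  refine ⟨fun _ => ⟨zero_le_one, le_rfl⟩, fun t => ?_, ?_⟩
  · obtain ⟨h1, h2⟩ := getD_reverse_bounds hl (hT.symm ▸ t.2 : (t : ℕ) < l.length)
    exact isCostFunction_linear hL h1 h2
  · exact Finset.single_le_sum (f := (linearInstance T l).d) (fun _ _ => zero_le_one)
      (Finset.mem_filter.2 ⟨Finset.mem_univ (⟨N, hN⟩ : Fin T), le_rfl⟩)

lemma OnlineAlgorithm.run_linearInstance (A : OnlineAlgorithm) {T : ℕ} {l : List ℝ}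
    (hT : l.length = T) (t : Fin T) :
    A.run (linearInstance T l) t = A.policy T (l.drop (T - (t + 1))) := by
  have ht := t.2
  have hne : l.drop (T - (t + 1)) ≠ [] := by
    rw [ne_eq, List.drop_eq_nil_iff]
    omega
  have hg : List.ofFn (linearInstance T l).g = l.reverse.map fun p x => p * x := by
    apply List.ext_getElem
    · simp [linearInstance, hT]
    · intro i h1 h2
      have h3 : i < l.reverse.length := by simpa using h2
      simp only [linearInstance, List.getElem_ofFn, List.getElem_map]
      rw [List.getD_eq_getElem _ _ h3]
  change A.decide T (fun _ => 1) ((List.ofFn (linearInstance T l).g).take (t + 1)) = _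
  rw [OnlineAlgorithm.policy, if_neg hne, hg, ← List.map_take, List.reverse_drop, hT,
    show T - (T - ((t : ℕ) + 1)) = t + 1 by omega]

lemma OnlineAlgorithm.extend_run_linearInstance (A : OnlineAlgorithm) {T : ℕ} {l : List ℝ}
    (hT : l.length = T) {t : ℕ} (ht : t ≤ T) :
    extend (A.run (linearInstance T l)) t = A.policy T (l.drop (T - t)) := by
  cases t with
  | zero => simp [extend, OnlineAlgorithm.policy, ← hT]
  | succ t =>
    have h : t < (linearInstance T l).T := ht
    rw [extend, dif_pos h]
    exact A.run_linearInstance hT ⟨t, ht⟩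

lemma bought_eq_sum (X : List ℝ → ℝ) (l : List ℝ) :
    bought X l = ∑ i ∈ Finset.range l.length, X (l.drop (l.length - (i + 1))) := by
  induction l with
  | nil => rfl
  | cons p l ih =>
    rw [bought, ih, List.length_cons, Finset.sum_range_succ, Nat.sub_self, List.drop_zero, add_comm]
    congr 1
    refine Finset.sum_congr rfl fun i hi => ?_
    have := Finset.mem_range.1 hi
    rw [show l.length + 1 - (i + 1) = l.length - (i + 1) + 1 by omega, List.drop_succ_cons]

lemma spent_eq_sum (β : ℝ) (X : List ℝ → ℝ) (l : List ℝ) :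
    spent β X l = ∑ i ∈ Finset.range l.length,
      (l.reverse.getD i 0 * X (l.drop (l.length - (i + 1))) +
        β * |X (l.drop (l.length - (i + 1))) - X (l.drop (l.length - i))|) := by
  induction l with
  | nil => rfl
  | cons p l ih =>
    rw [spent, ih, List.length_cons, Finset.sum_range_succ, Nat.sub_self, List.drop_zero, add_comm]
    congr 1
    · refine Finset.sum_congr rfl fun i hi => ?_
      have := Finset.mem_range.1 hi
      rw [show l.length + 1 - (i + 1) = l.length - (i + 1) + 1 by omega, List.drop_succ_cons,
        show l.length + 1 - i = l.length - i + 1 by omega, List.drop_succ_cons, List.reverse_cons,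
        List.getD_append _ _ _ _ (by simpa using this)]
    · simp

lemma OnlineAlgorithm.sum_run_linearInstance (A : OnlineAlgorithm) {T : ℕ} {l : List ℝ}
    (hT : l.length = T) :
    ∑ t, A.run (linearInstance T l) t = bought (A.policy T) l := by
  rw [bought_eq_sum, hT, Finset.sum_range]
  exact Finset.sum_congr rfl fun t _ => A.run_linearInstance hT t

lemma OnlineAlgorithm.cost_run_linearInstance (A : OnlineAlgorithm) (β : ℝ) {T : ℕ} {l : List ℝ}
    (hT : l.length = T) (hX : 0 ≤ A.policy T l) :
    cost β (linearInstance T l) (A.run (linearInstance T l)) =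
      spent β (A.policy T) l + β * A.policy T l := by
  have hlast : extend (A.run (linearInstance T l)) (T + 1) = 0 :=
    dif_neg (lt_irrefl T)
  change ∑ t : Fin T, l.reverse.getD t 0 * A.run (linearInstance T l) t +
    ∑ t ∈ Finset.range (T + 1), _ = _
  rw [Finset.sum_range_succ, hlast, A.extend_run_linearInstance hT le_rfl, Nat.sub_self,
    List.drop_zero, zero_sub, abs_neg, abs_of_nonneg hX, ← add_assoc, spent_eq_sum,
    Finset.sum_add_distrib, hT]
  congr 2
  · rw [Finset.sum_range]
    exact Finset.sum_congr rfl fun t _ => by rw [A.run_linearInstance hT t]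
  · refine Finset.sum_congr rfl fun t ht => ?_
    have := Finset.mem_range.1 ht
    rw [A.extend_run_linearInstance hT (t := t + 1) (by omega),
      A.extend_run_linearInstance hT (t := t) (by omega)]

/-! ### The offline optimum on linear inputs -/

lemma sum_range_ite_block {a K T : ℕ} (h : a + K ≤ T) (v : ℝ) :
    ∑ t ∈ Finset.range T, (if a ≤ t ∧ t < a + K then v else 0) = K * v := by
  rw [← Finset.sum_filter, show (Finset.range T).filter (fun t => a ≤ t ∧ t < a + K) =
    Finset.Ico a (a + K) by ext t; simp; omega]
  simp

/-- Spreading the demand evenly over a block of `K` steps at the price `p`. -/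
lemma exists_feasible_cost_le {β p : ℝ} {K T : ℕ} (hK : 0 < K) {l : List ℝ}
    (hT : l.length = T) (hl : HasBlock K p l) :
    ∃ y ∈ feasible (linearInstance T l), cost β (linearInstance T l) y ≤ p + 2 * β / K := by
  obtain ⟨l₁, l₂, rfl⟩ := hl
  -- Histories list the latest price first, so l₂ precedes the block in time.
  set a := l₂.length with ha
  simp only [List.length_append, List.length_replicate] at hT
  have hK' : (0 : ℝ) < K := Nat.cast_pos.2 hK
  have haK : a + K ≤ T := by omega
  let y : Fin T → ℝ := fun t => if a ≤ (t : ℕ) ∧ (t : ℕ) < a + K then 1 / (K : ℝ) else 0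
  have hy : ∀ t, extend y t = if a < t ∧ t ≤ a + K then 1 / (K : ℝ) else 0 := by
    intro t
    cases t with
    | zero => simp [extend]
    | succ t =>
      rw [extend]
      simp only [y, Nat.lt_succ_iff, Nat.succ_le_iff]
      split_ifs <;> first | rfl | omega
  refine ⟨y, ⟨fun t => ?_, ?_⟩, ?_⟩
  · change 0 ≤ y t ∧ y t ≤ 1
    simp only [y]
    split_ifs
    · exact ⟨by positivity, (div_le_one hK').2 (by exact_mod_cast hK)⟩
    · exact ⟨le_rfl, zero_le_one⟩
  · change ∑ t : Fin T, y t = 1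
    simp only [y]
    rw [← Finset.sum_range (fun t => if a ≤ t ∧ t < a + K then 1 / (K : ℝ) else 0),
      sum_range_ite_block haK]
    field_simp
  · refine add_le_add (le_of_eq ?_) ?_
    · change ∑ t : Fin T, (l₁ ++ (List.replicate K p ++ l₂)).reverse.getD t 0 * y t = p
      have h1 : ∀ t : Fin T, (l₁ ++ (List.replicate K p ++ l₂)).reverse.getD t 0 * y t =
          if a ≤ (t : ℕ) ∧ (t : ℕ) < a + K then p * (1 / (K : ℝ)) else 0 := by
        intro t
        simp only [y]
        split_ifs with h
        · congr 1
          rw [List.reverse_append, List.reverse_append, List.reverse_replicate,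
            List.getD_append _ _ _ _ (by simp; omega),
            List.getD_append_right _ _ _ _ (by simp; omega),
            List.getD_eq_getElem _ _ (by simp; omega), List.getElem_replicate]
        · exact mul_zero _
      rw [Finset.sum_congr rfl fun t _ => h1 t,
        ← Finset.sum_range (fun t => if a ≤ t ∧ t < a + K then p * (1 / (K : ℝ)) else 0),
        sum_range_ite_block haK]
      field_simp
    · change ∑ t ∈ Finset.range (T + 1), β * |extend y (t + 1) - extend y t| ≤ _
      -- The rate changes only on entering and on leaving the block, by 1/K each time.
      have h1 : ∀ t ∈ Finset.range (T + 1), β * |extend y (t + 1) - extend y t| ≤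
          (if t = a then β * (1 / (K : ℝ)) else 0) +
            (if t = a + K then β * (1 / (K : ℝ)) else 0) := by
        intro t _
        rw [hy, hy]
        have hpos : 0 ≤ 1 / (K : ℝ) := by positivity
        split_ifs <;> first
          | omega
          | simp
      refine (Finset.sum_le_sum h1).trans (le_of_eq ?_)
      rw [Finset.sum_add_distrib, Finset.sum_ite_eq', Finset.sum_ite_eq',
        if_pos (Finset.mem_range.2 (by omega)), if_pos (Finset.mem_range.2 (by omega))]
      ring

lemma opt_le {β : ℝ} (hβ : 0 ≤ β) {L U : ℝ} {N : ℕ} {I : Instance}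
    (hI : I ∈ validInstances L U N) {y : Fin I.T → ℝ} (hy : y ∈ feasible I) :
    opt β I ≤ cost β I y := by
  refine csInf_le ⟨0, ?_⟩ ⟨y, hy, rfl⟩
  rintro _ ⟨z, hz, rfl⟩
  refine add_nonneg (Finset.sum_nonneg fun t _ => ?_)
    (Finset.sum_nonneg fun t _ => mul_nonneg hβ (abs_nonneg _))
  exact (hI.2.1 t).nonneg _ ⟨(hz.1 t).1, (hz.1 t).2.trans (hI.1 t).2⟩

lemma le_opt_linearInstance {β : ℝ} (hβ : 0 ≤ β) {L U : ℝ} {T : ℕ} {l : List ℝ}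
    (hl : ∀ p ∈ l, L ≤ p ∧ p ≤ U) (hT : l.length = T)
    (hne : (feasible (linearInstance T l)).Nonempty) : L ≤ opt β (linearInstance T l) := by
  refine le_csInf (hne.image _) ?_
  rintro _ ⟨z, hz, rfl⟩
  refine le_add_of_le_of_nonneg ?_
    (Finset.sum_nonneg fun t _ => mul_nonneg hβ (abs_nonneg _))
  have h : L * ∑ t, z t ≤ ∑ t, (linearInstance T l).g t (z t) := by
    rw [Finset.mul_sum]
    refine Finset.sum_le_sum fun t _ => mul_le_mul_of_nonneg_right ?_ (hz.1 t).1
    exact (getD_reverse_bounds hl (hT ▸ t.2)).1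
  rwa [hz.2, mul_one] at h

/-! ### From competitive algorithms to policies -/

section Algorithm

variable {L U : ℝ} {N T : ℕ} {A : OnlineAlgorithm}

lemma IsHistory.fill {l : List ℝ} (hl : IsHistory L U T l) (hLU : L ≤ U) :
    IsHistory L U T (List.replicate (T - l.length) U ++ l) :=
  hl.replicate_append hLU le_rfl (by have := hl.1; omega)

lemma IsHistory.length_fill {l : List ℝ} (hl : IsHistory L U T l) :
    (List.replicate (T - l.length) U ++ l).length = T := by
  have := hl.1
  simp
  omega

/-- Feasibility is known only for complete inputs, so a history is filled up with the price U;
decisions already taken do not see the filling. -/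
lemma OnlineAlgorithm.Solves.isPolicy (hA : A.Solves (validInstances L U N)) (hL : 0 ≤ L)
    (hLU : L ≤ U) (hN : N < T) : IsPolicy L U T (A.policy T) := by
  have hfeas : ∀ l, IsHistory L U T l → A.run (linearInstance T
      (List.replicate (T - l.length) U ++ l)) ∈ feasible _ := fun l hl =>
    hA _ (linearInstance_mem_validInstances hL hN (hl.fill hLU).2 hl.length_fill)
  have hnonneg : ∀ l, IsHistory L U T l → 0 ≤ A.policy T l := by
    intro l hl
    rcases List.eq_nil_or_concat l with rfl | ⟨l', p, hlp⟩
    · simp [OnlineAlgorithm.policy]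
    · have hlen : 0 < l.length := by simp [hlp]
      have hlT := hl.1
      have h := ((hfeas l hl).1 ⟨l.length - 1, show _ < T by omega⟩).1
      have hrun := A.run_linearInstance hl.length_fill ⟨l.length - 1, by omega⟩
      rw [Fin.val_mk, show T - (l.length - 1 + 1) = T - l.length by omega,
        List.drop_left' (by simp)] at hrun
      exact hrun ▸ h
  refine ⟨by simp [OnlineAlgorithm.policy], hnonneg, fun l hl => ?_⟩
  have h := (hfeas l hl).2
  rw [A.sum_run_linearInstance hl.length_fill] at h
  exact h ▸ bought_mono_replicate hnonneg (hl.fill hLU)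

/-- If the algorithm is `r`-competitive, its cost is bounded by the cost of the offline solution
that uses a block of `K` steps at the price `p`. -/
lemma OnlineAlgorithm.Solves.excess_le (hA : A.Solves (validInstances L U N)) (hL : 0 < L)
    (hLU : L ≤ U) (hN : N < T) {β r : ℝ} (hβ : 0 < β) (hr0 : 0 ≤ r)
    (hr : ∀ I ∈ validInstances L U N, cost β I (A.run I) / opt β I ≤ r) {K : ℕ} (hK : 0 < K)
    {l : List ℝ} {p : ℝ} (hl : IsHistory L U T l) (hb : HasBlock K p l) :
    U + excess U β (A.policy T) l ≤ r * (p + 2 * β / K) := by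
  have hX := hA.isPolicy hL.le hLU hN
  have htop := excess_replicate_top_ge (U := U) (X := A.policy T) hβ l (T - l.length)
  have hfull := hl.fill hLU
  have hlen := hl.length_fill
  have hb' : HasBlock K p (List.replicate (T - l.length) U ++ l) := by
    obtain ⟨l₁, l₂, h⟩ := hb
    exact ⟨List.replicate (T - l.length) U ++ l₁, l₂, by rw [h, List.append_assoc]⟩
  set l' := List.replicate (T - l.length) U ++ l
  have hI := linearInstance_mem_validInstances hL.le hN hfull.2 hlen
  have hsum := A.sum_run_linearInstance hlen
  rw [(hA _ hI).2] at hsum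
  obtain ⟨y, hy, hcost⟩ := exists_feasible_cost_le (β := β) hK hlen hb'
  have hopt : 0 < opt β (linearInstance T l') :=
    hL.trans_le (le_opt_linearInstance hβ.le hfull.2 hlen ⟨y, hy⟩)
  have h1 := (div_le_iff₀ hopt).1 (hr _ hI)
  rw [A.cost_run_linearInstance β hlen (hX.nonneg _ hfull)] at h1
  have h2 := mul_le_mul_of_nonneg_left ((opt_le hβ.le hI hy).trans hcost) hr0
  unfold excess at htop ⊢
  rw [← hsum] at htop
  linarith

end Algorithm

/-- An `r`-competitive algorithm exists only if the threshold function started at `U - 2 * β - c`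
with rate `r` does not exceed the total demand. -/
lemma OnlineAlgorithm.Solves.ratio_bound {L U β r c s : ℝ} {N : ℕ} {A : OnlineAlgorithm}
    (hA : A.Solves (validInstances L U N)) (hL : 0 < L) (hLU : L < U) (hβ : 0 < β) (hr0 : 0 ≤ r)
    (hr : ∀ I ∈ validInstances L U N, cost β I (A.run I) / opt β I ≤ r) (hc : 0 < c) (hs : 0 < s)
    (hcs : c * Real.exp s = U - 2 * β - L) :
    (U - r * (U - 2 * β - c)) / c + r * s ≤ 1 := by
  by_contra! hgt
  set γ := (U - r * (U - 2 * β - c)) / c + r * s - 1 with hγ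
  have hγ0 : 0 < γ := by linarith
  -- The surplus γ absorbs three errors of at most γ/4: from m(1 - 1/q) in place of s (choice of m),
  -- from the offline switching cost (K), and from the m + 1 blocks (δ). Then ε must beat the growth
  -- (1 + M)^K.
  obtain ⟨m, hm⟩ := exists_nat_gt (max 1 (r * s ^ 2 * 4 / γ))
  have hm1 : (1 : ℝ) < m := (le_max_left _ _).trans_lt hm
  have hm0 : (0 : ℝ) < m := by linarith
  have hm2 : r * s ^ 2 * 4 < m * γ := (div_lt_iff₀ hγ0).1 ((le_max_right _ _).trans_lt hm)
  obtain ⟨K, hK⟩ := exists_nat_gt (max 0 (r * (2 * β) * 4 / (γ * c)))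
  have hK0 : (0 : ℝ) < K := (le_max_left _ _).trans_lt hK
  have hK1 : r * (2 * β / K) / c ≤ γ / 4 := by
    have h := (div_lt_iff₀ (by positivity)).1 ((le_max_right _ _).trans_lt hK)
    rw [mul_div_assoc', div_div, div_le_div_iff₀ (by positivity) (by norm_num)]
    linarith
  set δ := γ * c / (8 * (m + 1)) with hδ
  have hδ0 : 0 < δ := by positivity
  have hδ1 : (m + 1) * (2 * δ / c) = γ / 4 := by
    rw [hδ]; field_simp; norm_num
  set M := 4 * β / δ with hM
  have hM0 : 0 < M := by positivity
  have hM1 : 4 * β = δ * M := by rw [hM]; field_simp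
  have hUL : 0 < U - L := by linarith
  set ε := δ / ((U - L) * (1 + M) ^ K) with hε
  have hε0 : 0 < ε := by positivity
  have hε1 : (U - L) * (ε * (1 + M) ^ K) ≤ δ := by
    rw [hε]; apply le_of_eq; field_simp
  obtain ⟨H, hH⟩ := exists_nat_gt (1 / ε)
  obtain ⟨n, hn⟩ := exists_nat_gt (1 / (M * ε))
  have hH1 := (div_lt_iff₀ hε0).1 hH
  have hn1 := ((div_lt_iff₀ (by positivity)).1 hn).le
  -- The term N + 1 leaves a step after N, and one step with rate constraint 1 can carry the whole
  -- demand.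
  set T := (m + 1) * ((n + 1) * (H + K)) + N + 1
  have hN : N < T := by omega
  have hexp : Real.exp (s / m) ^ m = Real.exp s := by
    rw [← Real.exp_nat_mul, mul_div_cancel₀ _ hm0.ne']
  have h := (hA.isPolicy (T := T) hL.le hLU.le hN).ratio_bound hβ hLU.le hε0 hδ0 hM1 hM0 hH1 hε1
    hn1 (fun l p hl hb => hA.excess_le hL hLU.le hN hβ hr0 hr (Nat.cast_pos.1 hK0) hl hb) hc
    (Real.one_le_exp (by positivity : 0 ≤ s / m)) m (by rw [hexp, hcs]) (by omega)
  have hq : r * s - γ / 4 ≤ m * (r * (1 - 1 / Real.exp (s / m))) := by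
    have h1 : s / (m + s) ≤ 1 - 1 / Real.exp (s / m) := by
      have h2 : 1 / Real.exp (s / m) ≤ 1 / (s / m + 1) :=
        one_div_le_one_div_of_le (by positivity) (Real.add_one_le_exp _)
      have h3 : 1 - 1 / (s / m + 1) = s / (m + s) := by field_simp; ring
      linarith
    have h2 : r * s - γ / 4 ≤ m * (r * (s / (m + s))) := by
      rw [← mul_assoc, mul_div_assoc', le_div_iff₀ (by positivity)]
      have := mul_pos hγ0 hs
      nlinarith
    exact h2.trans (mul_le_mul_of_nonneg_left (mul_le_mul_of_nonneg_left h1 hr0) hm0.le)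
  rw [sub_div _ (2 * δ), sub_div _ (r * (2 * β / K)), mul_sub (m : ℝ)] at h
  linarith

/-! ### The Lambert function and α -/

/-- With t = u - w, one has u e^t - w = (1 + w)(e^t - 1) + (1 - (1 - t)e^t), and both summands are
nonnegative. -/
lemma mul_exp_le_mul_exp {w u : ℝ} (hw : -1 ≤ w) (hwu : w ≤ u) :
    w * Real.exp w ≤ u * Real.exp u := by
  have h1 : (1 - (u - w)) * Real.exp (u - w) ≤ 1 := by
    have h := Real.add_one_le_exp (-(u - w))
    calc (1 - (u - w)) * Real.exp (u - w) ≤ Real.exp (-(u - w)) * Real.exp (u - w) :=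
          mul_le_mul_of_nonneg_right (by linarith) (Real.exp_pos _).le
      _ = 1 := by rw [← Real.exp_add, neg_add_cancel, Real.exp_zero]
  have h2 : 1 ≤ Real.exp (u - w) := Real.one_le_exp (by linarith)
  have h3 : w ≤ u * Real.exp (u - w) := by
    nlinarith [mul_nonneg (by linarith : 0 ≤ 1 - (u - w) + u)
      (by linarith : 0 ≤ Real.exp (u - w) - 1)]
  have h4 : u * Real.exp u = u * Real.exp (u - w) * Real.exp w := by
    rw [mul_assoc, ← Real.exp_add, sub_add_cancel]
  rw [h4]
  exact mul_le_mul_of_nonneg_right h3 (Real.exp_pos _).le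

/-- The intermediate value theorem on [u, 0] provides a preimage, which makes the choice in
`lambertW` meaningful. -/
lemma lambertW_spec {u z : ℝ} (hu : -1 ≤ u) (hu0 : u ≤ 0) (huz : u * Real.exp u ≤ z)
    (hz : z ≤ 0) : -1 ≤ lambertW z ∧ lambertW z * Real.exp (lambertW z) = z := by
  have hcont : ContinuousOn (fun x : ℝ => x * Real.exp x) (Set.Icc u 0) := by fun_prop
  obtain ⟨x, hx, hxz⟩ := intermediate_value_Icc hu0 hcont (by simpa using ⟨huz, hz⟩ :
    z ∈ Set.Icc ((fun x : ℝ => x * Real.exp x) u) ((fun x : ℝ => x * Real.exp x) 0))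
  have h : ∃ a ∈ Set.Ici (-1 : ℝ), a * Real.exp a = z := ⟨x, hu.trans hx.1, hxz⟩
  exact ⟨Function.invFunOn_mem h, Function.invFunOn_eq h⟩

/-- The threshold function with rate `(alpha L U β)⁻¹` runs from `U * (alpha L U β)⁻¹` to `L`. -/
lemma inv_alpha_spec {L U β : ℝ} (hL : 0 < L) (hβ : 0 < β) (hβ' : β < (U - L) / 2) :
    0 < (alpha L U β)⁻¹ ∧ U * (alpha L U β)⁻¹ < U - 2 * β ∧
      (U - 2 * β - U * (alpha L U β)⁻¹) * Real.exp (alpha L U β)⁻¹ = U - 2 * β - L := by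
  have hU : 0 < U := by linarith
  rw [alpha, inv_inv]
  set b := 2 * β / U with hb
  have hUb : U * b = 2 * β := by rw [hb]; field_simp
  have hUL : U * (L / U) = L := by field_simp
  have hLpos : 0 < L / U := by positivity
  have hbpos : 0 < b := by positivity
  set u := b + L / U - 1 with hu
  have hu0 : u < 0 := by nlinarith
  set z := u * Real.exp (b - 1) with hz
  have hz0 : z < 0 := mul_neg_of_neg_of_pos hu0 (Real.exp_pos _)
  have huz : u * Real.exp u < z :=
    mul_lt_mul_of_neg_left (Real.exp_lt_exp.2 (by linarith)) hu0
  obtain ⟨hw, hwz⟩ := lambertW_spec (by linarith) hu0.le huz.le hz0.le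
  set w := lambertW z
  -- The bounds u < w < 0 give 1/α = w - b + 1 > L/U and U/α < U - 2β.
  have huw : u < w := by
    by_contra! h
    linarith [mul_exp_le_mul_exp hw h]
  have hw0 : w < 0 := by
    by_contra! h
    linarith [mul_nonneg h (Real.exp_pos w).le]
  refine ⟨by linarith, by nlinarith, ?_⟩
  have h1 : Real.exp (w - b + 1) = Real.exp w * Real.exp (1 - b) := by
    rw [← Real.exp_add]; ring_nf
  have h2 : w * Real.exp w * Real.exp (1 - b) = u := by
    rw [hwz, hz, mul_assoc, ← Real.exp_add]; simp
  rw [h1, show U - 2 * β - U * (w - b + 1) = -U * w by linear_combination hUb]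
  linear_combination (-U) * h2 - hUb - hUL

end OCS

/-- Every deterministic online algorithm has competitive ratio at least `α`, even on the inputs
whose compulsory trade begins after an arbitrarily late step `N`. -/
theorem theorem3p2 (L U β : ℝ) (hL : 0 < L) (hβ : 0 < β) (hβ' : β < (U - L) / 2) (N : ℕ)
    (A : OCS.OnlineAlgorithm) (hA : A.Solves (OCS.validInstances L U N)) :
    (OCS.alpha L U β : EReal) ≤ A.competitiveRatio β (OCS.validInstances L U N) := by
  obtain ⟨hs, hlt, hexp⟩ := OCS.inv_alpha_spec hL hβ hβ'
  have hα : 0 < OCS.alpha L U β := inv_pos.1 hs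
  by_contra! h
  -- The maximum with 0 makes r positive.
  obtain ⟨r, hr, hrα⟩ := EReal.lt_iff_exists_real_btwn.1
    (max_lt h (EReal.coe_pos.2 hα) : max _ (0 : EReal) < _)
  have hr0 : 0 < r := EReal.coe_pos.1 ((le_max_right _ _).trans_lt hr)
  have hrα' : r < OCS.alpha L U β := EReal.coe_lt_coe_iff.1 hrα
  have hratio : ∀ I ∈ OCS.validInstances L U N,
      OCS.cost β I (A.run I) / OCS.opt β I ≤ r := fun I hI =>
    EReal.coe_le_coe_iff.1
      ((le_iSup₂ (f := fun I (_ : I ∈ OCS.validInstances L U N) =>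
        ((OCS.cost β I (A.run I) / OCS.opt β I : ℝ) : EReal)) I hI).trans
        ((le_max_left _ _).trans hr.le))
  have hrs : r * (OCS.alpha L U β)⁻¹ < 1 := by
    rw [← div_eq_mul_inv, div_lt_one hα]
    exact hrα'
  set s := (OCS.alpha L U β)⁻¹
  have hc : 0 < U - 2 * β - U * s := by linarith
  have hkey := hA.ratio_bound hL (by linarith) hβ hr0.le hratio hc hs hexp
  have hU : 0 < U * s := mul_pos (by linarith) hs
  -- The numerator is U(1 - rs), with rs < 1 and c = U - 2β - Us < U.
  have hlt1 : 1 - r * s < (U - r * (U - 2 * β - (U - 2 * β - U * s))) / (U - 2 * β - U * s) := by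
    rw [lt_div_iff₀ hc]
    nlinarith
  linarith
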